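/- Let $\mathbb F$ be a finite field with $q$ elements and let $b\ge 0$. A matrix polynomial $G=\sum_i G_ix^i\in\mathbb F[x]^{b\times b}$ generates a sequence $S=(S_k)_{k\ge 0}$ of $b\times b$ matrices over $\mathbb F$ if $\det G\neq 0$ and $\sum_i S_{k+i}G_i=0$ for all $k\ge 0$. It is a minimal generator of $S$ if moreover its columns form a basis of the $\mathbb F[x]$-module of all $v=\sum_i v_ix^i\in\mathbb F[x]^b$ with $\sum_i S_{k+i}v_i=0$ for all $k\ge0$. The invariant factors of a square polynomial matrix are the normalized (monic or zero) diagonal entries of its Smith normal form; they are listed from the largest to the smallest, each dividing the preceding one, and the list is continued by $1$'s beyond the size of the matrix. For $A\in\mathbb F^{n\times n}$ and $r\ge 0$, $G$ is $r$-faithful to $A$ if the $r$ largest invariant factors of $G$ equal the $r$ largest invariant factors of $xI-A$. Let $P_{q,b,r}(A)$ be the probability, for $U,V\in\mathbb F^{n\times b}$ chosen uniformly and independently, that a minimal generator of the sequence $(U^{T}A^kV)_{k\ge0}$ is $r$-faithful to $A$. For a monic polynomial $f=x^d+f_{d-1}x^{d-1}+\dots+f_0$ let $C_f$ be its $d\times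 d$ companion matrix (ones just below the diagonal, last column $-f_0,\dots,-f_{d-1}$, zeros elsewhere), and for $e\ge 1$ let $J_{f^e}$ be the $e\times e$ block matrix with blocks $C_f$ on the diagonal, $d\times d$ identity blocks just below the diagonal, and zero blocks elsewhere. **Theorem.** Let $f\in\mathbb F[x]$ be monic and irreducible, let $m\ge 1$, let $e_1\ge e_2\ge\dots\ge e_m\ge 1$ be integers, put $J_i=J_{f^{e_i}}$, and let $t$ be the greatest index with $e_t=e_1$. Then for all $b\ge 0$ and all $0\le r\le t$, $$P_{q,b,r}\Bigl(\bigoplus_{i=1}^m J_i\Bigr)=P_{q,b,r}\Bigl(\bigoplus_{i=1}^t J_1\Bigr)=P_{q,b,r}\Bigl(\bigoplus_{i=1}^t C_f\Bigr).$$ -/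

import Mathlib

open Polynomial

namespace BlockWiedemann

variable {F : Type*} [Field F]

/-! ### Matrix sequences and their generators -/

/-- The `(U, V)`-projection of `A`: the sequence of `b × b` matrices `Uᵀ * A ^ k * V`. -/
def projection {ι : Type*} [Fintype ι] [DecidableEq ι] {b : ℕ}
    (A : Matrix ι ι F) (U V : Matrix ι (Fin b) F) : ℕ → Matrix (Fin b) (Fin b) F :=
  fun k => U.transpose * A ^ k * V

/-- The right action of a column vector of polynomials on a matrix sequence:
`(S v)_k = ∑ i, S_{k+i} v_i`, where `v_i` is the vector of coefficients of `x ^ i` in `v`. -/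
def seqMulVec {b : ℕ} (S : ℕ → Matrix (Fin b) (Fin b) F) (v : Fin b → F[X]) :
    ℕ → Fin b → F :=
  fun k p => ∑ l, (v l).sum fun i a => S (k + i) p l * a

/-- The right action of a matrix polynomial on a matrix sequence, column by column:
`(S G)_k = ∑ i, S_{k+i} G_i`. -/
def seqMul {b : ℕ} (S : ℕ → Matrix (Fin b) (Fin b) F) (G : Matrix (Fin b) (Fin b) F[X]) :
    ℕ → Matrix (Fin b) (Fin b) F :=
  fun k => Matrix.of fun p j => seqMulVec S (fun l => G l j) k p

/-- `G` generates the matrix sequence `S`: `det G ≠ 0` and `S G = 0`. -/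
def Generates {b : ℕ} (G : Matrix (Fin b) (Fin b) F[X])
    (S : ℕ → Matrix (Fin b) (Fin b) F) : Prop :=
  G.det ≠ 0 ∧ seqMul S G = 0

/-- `G` is a minimal generator of `S`: it generates `S`, and its columns form a basis of the
`F[X]`-module of all column vectors `v` with `S v = 0`. -/
def IsMinimalGenerator {b : ℕ} (G : Matrix (Fin b) (Fin b) F[X])
    (S : ℕ → Matrix (Fin b) (Fin b) F) : Prop :=
  Generates G S ∧ LinearIndependent F[X] G.col ∧
    ∀ v : Fin b → F[X], v ∈ Submodule.span F[X] (Set.range G.col) ↔ seqMulVec S v = 0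

/-! ### Invariant factors -/

/-- `s 0, s 1, s 2, …` are the invariant factors of the square polynomial matrix `M`, from the
largest to the smallest, continued by `1` beyond the size of `M`: each is monic (or zero),
divides the preceding one, and `M` is unimodularly equivalent to the diagonal matrix of the first
`n` of them, `n` being the size of `M`. The bijection `σ` numbers the rows and columns of `M`. -/
def HasInvariantFactors {ι : Type*} [Fintype ι] [DecidableEq ι]
    (M : Matrix ι ι F[X]) (s : ℕ → F[X]) : Prop :=
  (∀ i, s i = 0 ∨ (s i).Monic) ∧ (∀ i, s (i + 1) ∣ s i) ∧
    (∀ i, Fintype.card ι ≤ i → s i = 1) ∧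
    ∃ (σ : ι ≃ Fin (Fintype.card ι)) (X Y : Matrix ι ι F[X]), IsUnit X.det ∧ IsUnit Y.det ∧
      X * M * Y = Matrix.diagonal fun i => s (σ i)

/-- `G` is `r`-faithful to `A`: the `r` largest invariant factors of `G` are the `r` largest
invariant factors of `x I - A`. -/
def IsFaithful {ι : Type*} [Fintype ι] [DecidableEq ι] {b : ℕ} (r : ℕ)
    (G : Matrix (Fin b) (Fin b) F[X]) (A : Matrix ι ι F) : Prop :=
  ∃ s s' : ℕ → F[X], HasInvariantFactors G s ∧ HasInvariantFactors A.charmatrix s' ∧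
    ∀ i < r, s i = s' i

/-- The probability that, for `U` and `V` chosen uniformly and independently among the matrices
with `b` columns over the finite field `F`, the minimal generator of the `(U, V)`-projection of
`A` is `r`-faithful to `A`. -/
noncomputable def prob {ι : Type*} [Fintype ι] [DecidableEq ι] (b r : ℕ)
    (A : Matrix ι ι F) : ℚ :=
  (Nat.card {UV : Matrix ι (Fin b) F × Matrix ι (Fin b) F //
      ∃ G, IsMinimalGenerator G (projection A UV.1 UV.2) ∧ IsFaithful r G A} : ℚ) /
    (Nat.card (Matrix ι (Fin b) F × Matrix ι (Fin b) F) : ℚ)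

/-! ### Companion matrices and generalized Jordan blocks -/

/-- The companion matrix of a monic polynomial `f` of degree `d`: ones below the diagonal and last
column `-f_0, …, -f_{d-1}`. -/
def companion (f : F[X]) : Matrix (Fin f.natDegree) (Fin f.natDegree) F :=
  Matrix.of fun i j =>
    if (j : ℕ) + 1 = f.natDegree then -f.coeff i else if (i : ℕ) = j + 1 then 1 else 0

/-- The generalized Jordan block of `f ^ e`: an `e × e` array of `d × d` blocks, with the
companion matrix of `f` on the diagonal and identity blocks just below the diagonal. -/
def jordanBlock (f : F[X]) (e : ℕ) :
    Matrix (Fin e × Fin f.natDegree) (Fin e × Fin f.natDegree) F :=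
  Matrix.of fun i j =>
    if i.1 = j.1 then companion f i.2 j.2
    else if (i.1 : ℕ) = j.1 + 1 then (1 : Matrix _ _ F) i.2 j.2 else 0

end BlockWiedemann

namespace BlockWiedemann

/-! ### Smith normal form of a polynomial matrix whose cokernel is killed by a prime power -/

section Smith

variable {ι : Type*} [Fintype ι]

/-! Let $A=\bigoplus J_i$, $E=e_1$ and $C=\bigoplus_{i\le t}C_f$. The matrix $f(A)^E$ vanishes, and
$f(A)^{E-1}$ lives only in the bottom-left corners of the $t$ largest blocks. It factors as $PQ$
with $QA=CQ$ and $AP=PC$, where $Q$ has a right inverse and $P$ a left inverse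
(`IsTopFactorization`, `exists_isTopFactorization_jordan`).

The column space of a minimal generator is the annihilator of the sequence and contains $f^E\mathbb
F[x]^b$, so its invariant factors are powers $f^k$ with $k\le E$. The number of them equal to $f^E$
is read off from the index of $\{v : f^{E-1}v\in\text{column space}\}$ (`forall_lt_eq_pow_iff`). By
the factorization this module is the annihilator of the sequence of $C$ projected by $(P^TU,QV)$
(`smul_mem_annihilator_iff`). Since $r\le t$, the first $r$ invariant factors of $xI-A$ are all
$f^E$, so faithfulness is a condition on $(P^TU,QV)$ alone.

The map $(U,V)\mapsto(P^TU,QV)$ is a surjective homomorphism, so this pair is again uniform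
(`IsTopFactorization.prob_eq`). The resulting probability involves only $C$, $f$, $b$ and $r$; the
case $E=1$, $P=Q=I$ covers $C$ itself. -/

theorem exists_smith_basis_of_smul_mem {R M : Type*} [CommRing R] [IsDomain R]
    [IsPrincipalIdealRing R] [AddCommGroup M] [Module R M] (b : Module.Basis ι R M)
    (N : Submodule R M) {c : R} (hc : c ≠ 0) (hN : ∀ v : M, c • v ∈ N) :
    ∃ (b' : Module.Basis ι R M) (a : ι → R) (ab' : Module.Basis ι R N),
      ∀ i, (ab' i : M) = a i • b' i := by
  have : Module.Finite R M := Module.Finite.of_basis b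
  have : Module.Free R M := Module.Free.of_basis b
  -- Multiplication by `c` embeds `M` into `N`, so `N` has full rank and its basis can be indexed by
  -- all of `ι`.
  refine N.exists_smith_normal_form_of_rank_eq b (le_antisymm N.finrank_le ?_)
  let g : M →ₗ[R] N := (LinearMap.lsmul R M c).codRestrict N hN
  refine LinearMap.finrank_le_finrank_of_injective (f := g) fun x y hxy => ?_
  have : c • x = c • y := congrArg Subtype.val hxy
  have hinj := b.repr.injective
  apply hinj
  have h2 := congrArg b.repr this
  ext i
  have h3 := DFunLike.congr_fun h2 i
  simpa [hc] using h3

/-- The vectors which are mapped into the column space of `M` by multiplication by `c`. -/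
def colon {R : Type*} [CommRing R] (M : Matrix ι ι R) (c : R) : Submodule R (ι → R) :=
  (LinearMap.range M.mulVecLin).comap (LinearMap.lsmul R (ι → R) c)

theorem mem_colon {R : Type*} [CommRing R] {M : Matrix ι ι R} {c : R} {v : ι → R} :
    v ∈ colon M c ↔ ∃ w, M.mulVec w = c • v := by
  simp [colon]

variable [DecidableEq ι]

theorem isUnit_det_of_basis {R : Type*} [CommRing R] (b : Module.Basis ι R (ι → R)) :
    IsUnit (Matrix.of fun i j => b j i).det := by
  have h : (Matrix.of fun i j => b j i) = (Pi.basisFun R ι).toMatrix b := by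
    ext i j
    simp [Module.Basis.toMatrix_apply]
  rw [h]
  have := (Pi.basisFun R ι).isUnit_det b
  rwa [Module.Basis.det_apply] at this

theorem mulVec_injective_of_det_ne_zero {R : Type*} [CommRing R] [IsDomain R] {M : Matrix ι ι R}
    (hM : M.det ≠ 0) : Function.Injective M.mulVec := by
  intro x y hxy
  by_contra hne
  exact hM (Matrix.exists_mulVec_eq_zero_iff.mp
    ⟨x - y, sub_ne_zero.mpr hne, by rw [Matrix.mulVec_sub, hxy, sub_self]⟩)

theorem exists_diagonalization {R : Type*} [CommRing R] [IsDomain R] [IsPrincipalIdealRing R]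
    {M : Matrix ι ι R} (hM : M.det ≠ 0) {c : R} (hc : c ≠ 0)
    (hcM : ∀ v : ι → R, ∃ w, M.mulVec w = c • v) :
    ∃ (X Y : Matrix ι ι R) (a : ι → R), IsUnit X.det ∧ IsUnit Y.det ∧
      X * M * Y = Matrix.diagonal a := by
  obtain ⟨b', a, bN, h⟩ := exists_smith_basis_of_smul_mem (Pi.basisFun R ι)
    (LinearMap.range M.mulVecLin) hc (fun v => by
      obtain ⟨w, hw⟩ := hcM v
      exact ⟨w, by simpa using hw⟩)
  let φ := LinearEquiv.ofInjective M.mulVecLin (mulVec_injective_of_det_ne_zero hM)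
  let bY := bN.map φ.symm
  have hbY : ∀ j, M.mulVec (bY j) = a j • b' j := by
    intro j
    rw [← h j]
    have : φ (bY j) = bN j := by simp [bY]
    rw [← this]
    rfl
  set B : Matrix ι ι R := Matrix.of fun i j => b' j i with hB
  set Y : Matrix ι ι R := Matrix.of fun i j => bY j i with hY
  have hBdet : IsUnit B.det := isUnit_det_of_basis b'
  have hMY : M * Y = B * Matrix.diagonal a := by
    ext i j
    have := congrFun (hbY j) i
    rw [Matrix.mul_diagonal]
    simpa [Matrix.mul_apply, Matrix.mulVec, dotProduct, B, Y, mul_comm] using this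
  refine ⟨B⁻¹, Y, a, ?_, isUnit_det_of_basis bY, ?_⟩
  · exact (Matrix.isUnit_nonsing_inv_det_iff).mpr hBdet
  · rw [Matrix.mul_assoc, hMY, ← Matrix.mul_assoc, Matrix.nonsing_inv_mul _ hBdet, Matrix.one_mul]

variable {F : Type*} [Field F]

theorem mem_range_iff_diagonal {R : Type*} [CommRing R] {M X Y : Matrix ι ι R} {a : ι → R}
    (hX : IsUnit X.det) (hY : IsUnit Y.det) (h : X * M * Y = Matrix.diagonal a) (v : ι → R) :
    (∃ w, M.mulVec w = v) ↔ ∀ i, a i ∣ X.mulVec v i := by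
  constructor
  · rintro ⟨w, rfl⟩ i
    have h1 : X.mulVec (M.mulVec w) = (Matrix.diagonal a).mulVec (Y⁻¹.mulVec w) := by
      rw [← h]
      simp [Matrix.mulVec_mulVec, Matrix.mul_assoc, Matrix.mul_nonsing_inv _ hY]
    rw [h1, Matrix.mulVec_diagonal]
    exact dvd_mul_right _ _
  · intro hd
    choose u hu using hd
    refine ⟨Y.mulVec u, ?_⟩
    have h1 : X.mulVec (M.mulVec (Y.mulVec u)) = X.mulVec v := by
      rw [Matrix.mulVec_mulVec, Matrix.mulVec_mulVec, h]
      ext i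
      rw [Matrix.mulVec_diagonal, hu]
    have h2 := congrArg X⁻¹.mulVec h1
    simpa [Matrix.mulVec_mulVec, ← Matrix.mul_assoc, Matrix.nonsing_inv_mul _ hX] using h2

/-- Test membership on the vector that `X` sends to the `i`-th unit vector. -/
theorem diagonal_dvd {R : Type*} [CommRing R] {M X Y : Matrix ι ι R} {a : ι → R}
    (hX : IsUnit X.det) (hY : IsUnit Y.det) (h : X * M * Y = Matrix.diagonal a) {c : R}
    (hcM : ∀ v : ι → R, ∃ w, M.mulVec w = c • v) (i : ι) : a i ∣ c := by
  have := (mem_range_iff_diagonal hX hY h _).mp (hcM (X⁻¹.mulVec (Pi.single i 1))) i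
  rw [Matrix.mulVec_smul, Matrix.mulVec_mulVec, Matrix.mul_nonsing_inv _ hX] at this
  simpa using this

theorem eq_pow_of_monic_of_dvd {f s : F[X]} (hf : f.Monic) (hirr : Irreducible f) {e : ℕ}
    (hs : s = 0 ∨ s.Monic) (h : s ∣ f ^ e) : ∃ k ≤ e, s = f ^ k := by
  obtain ⟨k, hk, ha⟩ := (dvd_prime_pow hirr.prime e).mp h
  refine ⟨k, hk, ?_⟩
  rcases hs with rfl | hs
  · rw [zero_dvd_iff] at h
    exact absurd h (pow_ne_zero _ hirr.ne_zero)
  · exact eq_of_monic_of_associated hs (hf.pow k) ha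

/-- Each diagonal entry divides a power of the prime `f`, hence is a power of `f` up to a unit. The
units are absorbed into the right factor, and sorting the exponents gives the divisibility chain. -/
theorem exists_hasInvariantFactors {f : F[X]} (hf : f.Monic) (hirr : Irreducible f) {e : ℕ}
    {M : Matrix ι ι F[X]} (hM : M.det ≠ 0)
    (hcM : ∀ v : ι → F[X], ∃ w, M.mulVec w = f ^ e • v) : ∃ s, HasInvariantFactors M s := by
  obtain ⟨X, Y, a, hX, hY, h⟩ := exists_diagonalization hM (pow_ne_zero e hirr.ne_zero) hcM
  have ha : ∀ i, ∃ k : ℕ, ∃ u : F[X]ˣ, a i * u = f ^ k := fun i => by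
    obtain ⟨k, -, u, hu⟩ := (dvd_prime_pow hirr.prime e).mp (diagonal_dvd hX hY h hcM i)
    exact ⟨k, u, hu⟩
  choose k u hu using ha
  let n := Fintype.card ι
  let τ : Fin n ≃ ι := (Fintype.equivFin ι).symm
  -- The order dual turns the increasing sort into a decreasing one.
  let g : Fin n → ℕᵒᵈ := fun j => OrderDual.toDual (k (τ j))
  let ρ : Fin n ≃ ι := (Tuple.sort g).trans τ
  have hanti : Antitone fun j => k (ρ j) := fun i j hij => Tuple.monotone_sort g hij
  refine ⟨fun j => if hj : j < n then f ^ k (ρ ⟨j, hj⟩) else 1, fun j => ?_, fun j => ?_,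
    fun j hj => ?_, ρ.symm, X, Y * Matrix.diagonal fun i => (u i : F[X]), hX, ?_, ?_⟩
  · right
    dsimp only
    split_ifs
    exacts [hf.pow _, monic_one]
  · dsimp only
    split_ifs with h1 h2 h2
    · exact pow_dvd_pow _ (hanti (Fin.mk_le_mk.mpr (Nat.le_succ j)))
    · omega
    · exact one_dvd _
    · exact one_dvd _
  · exact dif_neg (not_lt.mpr hj)
  · rw [Matrix.det_mul, Matrix.det_diagonal]
    exact hY.mul (IsUnit.prod_univ_iff.mpr fun i => (u i).isUnit)
  · rw [← Matrix.mul_assoc, h, Matrix.diagonal_mul_diagonal]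
    congr 1
    ext1 i
    simp [hu, n]

/-! ### Counting the invariant factors equal to $f^e$ by an index -/

theorem card_quotient_comap {R : Type*} [CommRing R] {X : Matrix ι ι R} (hX : IsUnit X.det)
    (L : Submodule R (ι → R)) :
    Nat.card ((ι → R) ⧸ L.comap X.mulVecLin) = Nat.card ((ι → R) ⧸ L) := by
  have hs : Function.Surjective X.mulVecLin := fun v =>
    ⟨X⁻¹.mulVec v, by simp [Matrix.mulVec_mulVec, Matrix.mul_nonsing_inv _ hX]⟩
  exact AddSubgroup.index_comap_of_surjective L.toAddSubgroup
    (f := X.mulVecLin.toAddMonoidHom) hs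

/-- In diagonal coordinates the condition is $f^{k_i}\mid f^{e-1}x_i$: it means $f\mid x_i$ when
$k_i=e$ and is vacuous when $k_i<e$. -/
theorem card_quotient_colon {f : F[X]} (hirr : Irreducible f) {e : ℕ} (he : 0 < e)
    {M X Y : Matrix ι ι F[X]} {k : ι → ℕ} (hk : ∀ i, k i ≤ e)
    (hX : IsUnit X.det) (hY : IsUnit Y.det)
    (h : X * M * Y = Matrix.diagonal fun i => f ^ k i) :
    Nat.card ((ι → F[X]) ⧸ colon M (f ^ (e - 1))) =
      Nat.card (F[X] ⧸ Ideal.span {f}) ^ Fintype.card {i // k i = e} := by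
  have hL : colon M (f ^ (e - 1)) = (Submodule.pi Set.univ fun i =>
      (if k i = e then Ideal.span {f} else ⊤ : Ideal F[X])).comap X.mulVecLin := by
    ext v
    rw [mem_colon, mem_range_iff_diagonal hX hY h, Submodule.mem_comap, Submodule.mem_pi]
    refine forall_congr' fun i => ?_
    simp only [Set.mem_univ, forall_const, Matrix.mulVec_smul, Pi.smul_apply, smul_eq_mul,
      Matrix.mulVecLin_apply]
    split_ifs with hi
    · rw [Ideal.mem_span_singleton, hi]
      obtain ⟨e, rfl⟩ := Nat.exists_eq_succ_of_ne_zero he.ne'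
      rw [pow_succ, Nat.succ_sub_one]
      exact mul_dvd_mul_iff_left (pow_ne_zero _ hirr.ne_zero)
    · simp only [Submodule.mem_top, iff_true]
      have := hk i
      exact (pow_dvd_pow f (by omega)).mul_right _
  rw [hL, card_quotient_comap hX, Nat.card_congr (Submodule.quotientPi _).toEquiv, Nat.card_pi]
  have : ∀ i, Nat.card (F[X] ⧸ (if k i = e then Ideal.span {f} else ⊤ : Ideal F[X])) =
      if k i = e then Nat.card (F[X] ⧸ Ideal.span {f}) else 1 := by
    intro i
    split_ifs
    · rfl
    · exact Nat.card_unique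
  simp_rw [this]
  rw [Finset.prod_ite, Finset.prod_const, Finset.prod_const_one, mul_one, Fintype.card_subtype]

/-- The exponents decrease, so the first `r` are equal to `e` iff at least `r` of them are; the
index is the residue field size raised to that number. -/
theorem forall_lt_eq_pow_iff {f : F[X]} (hf : f.Monic) (hirr : Irreducible f) {e : ℕ}
    (he : 0 < e) {M : Matrix ι ι F[X]} (hcM : ∀ v : ι → F[X], ∃ w, M.mulVec w = f ^ e • v)
    {s : ℕ → F[X]} (hs : HasInvariantFactors M s)
    (hfin : 1 < Nat.card (F[X] ⧸ Ideal.span {f})) (r : ℕ) :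
    (∀ i < r, s i = f ^ e) ↔ Nat.card (F[X] ⧸ Ideal.span {f}) ^ r ≤
      Nat.card ((ι → F[X]) ⧸ colon M (f ^ (e - 1))) := by
  obtain ⟨hmon, hdvd, hone, σ, X, Y, hX, hY, h⟩ := hs
  have hle : ∀ i j, i ≤ j → s j ∣ s i := fun i j hij => by
    induction j, hij using Nat.le_induction with
    | base => exact dvd_rfl
    | succ j _ ih => exact (hdvd j).trans ih
  have hpow : ∀ i, ∃ k ≤ e, s i = f ^ k := fun i => by
    by_cases hi : i < Fintype.card ι
    · refine eq_pow_of_monic_of_dvd hf hirr (hmon i) ?_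
      simpa using diagonal_dvd hX hY h hcM (σ.symm ⟨i, hi⟩)
    · exact ⟨0, Nat.zero_le _, by rw [hone i (not_lt.mp hi), pow_zero]⟩
  choose k hk hsk using hpow
  have hinj : ∀ {a b : ℕ}, f ^ a = f ^ b ↔ a = b := fun {a b} => by
    refine ⟨fun hab => ?_, fun hab => hab ▸ rfl⟩
    have := congrArg natDegree hab
    rw [hf.natDegree_pow, hf.natDegree_pow] at this
    exact Nat.eq_of_mul_eq_mul_right hirr.natDegree_pos this
  have hkanti : ∀ i j, i ≤ j → k j ≤ k i := fun i j hij => by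
    have := hle i j hij
    rw [hsk, hsk] at this
    exact (pow_dvd_pow_iff hirr.ne_zero hirr.not_isUnit).mp this
  simp_rw [hsk, hinj] at h ⊢
  have hcard : Fintype.card {i // k (σ i) = e} =
      Fintype.card {j : Fin (Fintype.card ι) // k j = e} :=
    Fintype.card_congr (σ.subtypeEquiv fun i => Iff.rfl)
  rw [card_quotient_colon hirr he (fun i => hk (σ i)) hX hY h, Nat.pow_le_pow_iff_right hfin,
    hcard]
  -- The padding ones are $f^0\ne f^e$, since `0 < e`, so they never count.
  have hz : ∀ i, Fintype.card ι ≤ i → k i = 0 := fun i hi => by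
    have := hone i hi
    rw [hsk, ← pow_zero f, hinj] at this
    exact this
  constructor
  · intro hr
    have hlt : ∀ i < r, i < Fintype.card ι := fun i hi => by
      by_contra hc
      have h1 := hz i (not_lt.mp hc)
      have h2 := hr i hi
      omega
    calc r = Fintype.card (Fin r) := (Fintype.card_fin r).symm
      _ ≤ _ := Fintype.card_le_of_injective
        (fun i : Fin r => (⟨⟨i, hlt i i.2⟩, hr i i.2⟩ : {j : Fin (Fintype.card ι) // k j = e}))
        fun i j hij => by simpa [Fin.ext_iff] using hij
  · intro hr i hi
    by_contra hne
    have hlt : ∀ j : {j : Fin (Fintype.card ι) // k j = e}, (j : ℕ) < i := fun j => by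
      by_contra hc
      have h1 := hkanti i j (not_lt.mp hc)
      have h2 := hk i
      have h3 := j.2
      omega
    have := Fintype.card_le_of_injective
        (fun j : {j : Fin (Fintype.card ι) // k j = e} => (⟨j, hlt j⟩ : Fin i))
        fun a b hab => by simpa [Fin.ext_iff, Subtype.ext_iff] using hab
    rw [Fintype.card_fin] at this
    omega

end Smith

/-! ### Polynomial vectors acting through a matrix -/

section Krylov

variable {F : Type*} [Field F] {ι κ β : Type*} [Fintype ι] [DecidableEq ι] [Fintype κ]
  [DecidableEq κ] [Fintype β]

/-- The image of a polynomial vector `v` under `v ↦ ∑ i, A ^ i * V * v_i`. -/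
noncomputable def krylov (A : Matrix ι ι F) (V : Matrix ι β F) (v : β → F[X]) : ι → F :=
  ∑ l, (aeval A (v l)).mulVec (V.col l)

theorem krylov_add (A : Matrix ι ι F) (V : Matrix ι β F) (v w : β → F[X]) :
    krylov A V (v + w) = krylov A V v + krylov A V w := by
  simp [krylov, Matrix.add_mulVec, Finset.sum_add_distrib]

theorem krylov_zero (A : Matrix ι ι F) (V : Matrix ι β F) : krylov A V 0 = 0 := by
  simp [krylov]

theorem krylov_smul (A : Matrix ι ι F) (V : Matrix ι β F) (p : F[X]) (v : β → F[X]) :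
    krylov A V (p • v) = (aeval A p).mulVec (krylov A V v) := by
  simp [krylov, Matrix.mulVec_sum, Matrix.mulVec_mulVec]

theorem mul_aeval_of_mul_eq {A : Matrix ι ι F} {C : Matrix κ κ F} {Q : Matrix κ ι F}
    (h : Q * A = C * Q) (p : F[X]) : Q * aeval A p = aeval C p * Q := by
  induction p using Polynomial.induction_on' with
  | add p q hp hq => simp [Matrix.mul_add, Matrix.add_mul, hp, hq]
  | monomial n a =>
    have hn : Q * A ^ n = C ^ n * Q := by
      induction n with
      | zero => simp
      | succ n ih => rw [pow_succ, ← Matrix.mul_assoc, ih, Matrix.mul_assoc, h, pow_succ,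
          Matrix.mul_assoc]
    simp [aeval_monomial, Algebra.algebraMap_eq_smul_one, hn]

theorem mulVec_krylov {A : Matrix ι ι F} {C : Matrix κ κ F} {Q : Matrix κ ι F}
    (h : Q * A = C * Q) (V : Matrix ι β F) (v : β → F[X]) :
    Q.mulVec (krylov A V v) = krylov C (Q * V) v := by
  simp only [krylov, Matrix.mulVec_sum, Matrix.mulVec_mulVec, mul_aeval_of_mul_eq h]
  simp only [← Matrix.mulVec_mulVec]
  rfl

theorem seqMulVec_projection {b : ℕ} (A : Matrix ι ι F) (U V : Matrix ι (Fin b) F)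
    (v : Fin b → F[X]) (k : ℕ) :
    seqMulVec (projection A U V) v k = U.transpose.mulVec ((A ^ k).mulVec (krylov A V v)) := by
  ext p
  have h : U.transpose.mulVec ((A ^ k).mulVec (krylov A V v)) =
      ∑ l, (U.transpose * A ^ k * aeval A (v l)).mulVec (V.col l) := by
    simp [krylov, Matrix.mulVec_sum, Matrix.mulVec_mulVec, Matrix.mul_assoc]
  rw [h, Finset.sum_apply]
  refine Finset.sum_congr rfl fun l _ => ?_
  have h2 : (U.transpose * A ^ k * aeval A (v l)).mulVec (V.col l) =
      (v l).sum fun i a => a • (U.transpose * A ^ (k + i)).mulVec (V.col l) := by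
    rw [aeval_eq_sum_range, Polynomial.sum_over_range _ (by simp), Matrix.mul_sum,
      Matrix.sum_mulVec]
    refine Finset.sum_congr rfl fun i _ => ?_
    rw [Matrix.mul_smul, Matrix.smul_mulVec, Matrix.mul_assoc, ← pow_add]
  rw [h2, Polynomial.sum, Polynomial.sum, Finset.sum_apply]
  refine Finset.sum_congr rfl fun i _ => ?_
  rw [Pi.smul_apply, smul_eq_mul, mul_comm]
  rfl

/-- The polynomial vectors annihilating the `(U, V)`-projection of `A`. -/
noncomputable def annihilator (A : Matrix ι ι F) (U V : Matrix ι β F) :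
    Submodule F[X] (β → F[X]) where
  carrier := {v | ∀ p : F[X], U.transpose.mulVec ((aeval A p).mulVec (krylov A V v)) = 0}
  add_mem' := fun hv hw p => by
    rw [krylov_add, Matrix.mulVec_add, Matrix.mulVec_add, hv p, hw p, add_zero]
  zero_mem' := fun p => by rw [krylov_zero, Matrix.mulVec_zero, Matrix.mulVec_zero]
  smul_mem' := fun q v hv p => by
    rw [krylov_smul, Matrix.mulVec_mulVec (krylov A V v), ← map_mul]
    exact hv _

theorem mem_annihilator {A : Matrix ι ι F} {U V : Matrix ι β F} {v : β → F[X]} :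
    v ∈ annihilator A U V ↔
      ∀ p : F[X], U.transpose.mulVec ((aeval A p).mulVec (krylov A V v)) = 0 :=
  Iff.rfl

theorem seqMulVec_projection_eq_zero_iff {b : ℕ} {A : Matrix ι ι F} {U V : Matrix ι (Fin b) F}
    {v : Fin b → F[X]} : seqMulVec (projection A U V) v = 0 ↔ v ∈ annihilator A U V := by
  rw [mem_annihilator, funext_iff]
  simp only [seqMulVec_projection, Pi.zero_apply]
  constructor
  · intro h p
    induction p using Polynomial.induction_on' with
    | add p q hp hq => rw [map_add, Matrix.add_mulVec, Matrix.mulVec_add, hp, hq, add_zero]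
    | monomial n a =>
      rw [aeval_monomial, ← Algebra.smul_def, Matrix.smul_mulVec, Matrix.mulVec_smul, h, smul_zero]
  · intro h k
    simpa using h (X ^ k)

/-! ### The column space of the characteristic matrix -/

theorem charmatrix_mulVec (A : Matrix ι ι F) (w : ι → F[X]) :
    A.charmatrix.mulVec w = (X : F[X]) • w - (A.map C).mulVec w := by
  rw [Matrix.charmatrix, Matrix.sub_mulVec]
  congr 1
  ext1 i
  simp [Matrix.mulVec_diagonal]

theorem krylov_one_const (A : Matrix ι ι F) (y : ι → F) :
    krylov A (1 : Matrix ι ι F) (fun i => C (y i)) = y := by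
  ext j
  simp [krylov, Algebra.algebraMap_eq_smul_one, Matrix.smul_mulVec, Matrix.one_apply,
    Finset.sum_apply]

/-- Division of `v` by $xI-A$: the remainder is `v` evaluated at `A`. It suffices to treat
constants, sums and multiplication by $x$. -/
theorem exists_charmatrix_add_const (A : Matrix ι ι F) (v : ι → F[X]) :
    ∃ w, v = A.charmatrix.mulVec w + fun i => C (krylov A (1 : Matrix ι ι F) v i) := by
  have hconst : ∀ y : ι → F, ∃ w, (fun i => C (y i)) = A.charmatrix.mulVec w +
      fun i => C (krylov A (1 : Matrix ι ι F) (fun i => C (y i)) i) := fun y =>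
    ⟨0, by rw [krylov_one_const, Matrix.mulVec_zero, zero_add]⟩
  have hadd : ∀ v v' : ι → F[X],
      (∃ w, v = A.charmatrix.mulVec w + fun i => C (krylov A (1 : Matrix ι ι F) v i)) →
      (∃ w, v' = A.charmatrix.mulVec w + fun i => C (krylov A (1 : Matrix ι ι F) v' i)) →
      ∃ w, v + v' = A.charmatrix.mulVec w +
        fun i => C (krylov A (1 : Matrix ι ι F) (v + v') i) := by
    rintro v v' ⟨w, hw⟩ ⟨w', hw'⟩
    refine ⟨w + w', ?_⟩
    rw [krylov_add, Matrix.mulVec_add]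
    nth_rewrite 1 [hw, hw']
    ext1 i
    simp only [Pi.add_apply, map_add]
    ring
  have hX : ∀ v : ι → F[X],
      (∃ w, v = A.charmatrix.mulVec w + fun i => C (krylov A (1 : Matrix ι ι F) v i)) →
      ∃ w, (X : F[X]) • v = A.charmatrix.mulVec w +
        fun i => C (krylov A (1 : Matrix ι ι F) ((X : F[X]) • v) i) := by
    rintro v ⟨w, hw⟩
    -- If $v=(xI-A)w+c$ with $c$ constant, then $xv=(xI-A)(xw+c)+Ac$.
    refine ⟨(X : F[X]) • w + fun i => C (krylov A (1 : Matrix ι ι F) v i), ?_⟩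
    rw [krylov_smul, aeval_X, Matrix.mulVec_add, Matrix.mulVec_smul,
      charmatrix_mulVec A (fun i => C _)]
    nth_rewrite 1 [hw]
    rw [smul_add, add_assoc]
    congr 1
    ext1 i
    simp [Matrix.mulVec, dotProduct]
  have hsingle : ∀ (i : ι) (p : F[X]), ∃ w, p • (Pi.single i 1 : ι → F[X]) =
      A.charmatrix.mulVec w +
        fun j => C (krylov A (1 : Matrix ι ι F) (p • (Pi.single i 1 : ι → F[X])) j) := by
    intro i p
    induction p using Polynomial.induction_on with
    | C a =>
      have : (C a • Pi.single i 1 : ι → F[X]) = fun j => C (Pi.single (M := fun _ => F) i a j) := by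
        ext1 j
        by_cases hj : j = i
        · subst hj; simp
        · simp [hj]
      rw [this]
      exact hconst _
    | add p q hp hq => rw [add_smul]; exact hadd _ _ hp hq
    | monomial n a h =>
      have : C a * X ^ (n + 1) = X * (C a * X ^ n) := by ring
      rw [this, mul_smul]
      exact hX _ h
  have hv : v = ∑ i, v i • (Pi.single i 1 : ι → F[X]) := by
    ext1 j
    simp [Finset.sum_apply, Pi.single_apply]
  have hsum : ∀ s : Finset ι, ∃ w, ∑ i ∈ s, v i • (Pi.single i 1 : ι → F[X]) =
      A.charmatrix.mulVec w + fun j => C (krylov A (1 : Matrix ι ι F)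
        (∑ i ∈ s, v i • (Pi.single i 1 : ι → F[X])) j) := by
    intro s
    induction s using Finset.induction_on with
    | empty => exact ⟨0, by simp [krylov_zero]; rfl⟩
    | insert i s hi ih =>
      rw [Finset.sum_insert hi]
      exact hadd _ _ (hsingle i _) ih
  rw [hv]
  exact hsum _

theorem krylov_one_charmatrix (A : Matrix ι ι F) (w : ι → F[X]) :
    krylov A (1 : Matrix ι ι F) (A.charmatrix.mulVec w) = 0 := by
  have hw : A.charmatrix.mulVec w = ∑ j, w j • A.charmatrix.col j := by
    ext1 i
    simp [Matrix.mulVec, dotProduct, mul_comm]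
  have hcol : ∀ j, krylov A (1 : Matrix ι ι F) (A.charmatrix.col j) = 0 := by
    intro j
    have h1 := charmatrix_mulVec A (Pi.single j 1)
    rw [Matrix.mulVec_single_one, Matrix.mulVec_single_one] at h1
    have h2 : A.charmatrix.col j + (fun i => C (A i j)) =
        (X : F[X]) • fun i => C (Pi.single (M := fun _ => F) j 1 i) := by
      rw [h1]
      ext1 i
      by_cases hij : i = j
      · subst hij; simp
      · simp [hij]
    have h3 := congrArg (krylov A 1) h2
    rw [krylov_add, krylov_one_const, krylov_smul, krylov_one_const, aeval_X,
      Matrix.mulVec_single_one] at h3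
    exact add_eq_right.mp h3
  have hsum : ∀ s : Finset ι, krylov A (1 : Matrix ι ι F) (∑ j ∈ s, w j • A.charmatrix.col j) = 0 := by
    intro s
    induction s using Finset.induction_on with
    | empty => simp [krylov_zero]
    | insert j s hj ih =>
      rw [Finset.sum_insert hj, krylov_add, ih, krylov_smul, hcol, Matrix.mulVec_zero, add_zero]
  rw [hw]
  exact hsum _

/-- This identifies the cokernel of $xI-A$ with the space on which $x$ acts as $A$. -/
theorem mem_range_charmatrix_iff (A : Matrix ι ι F) (v : ι → F[X]) :
    (∃ w, A.charmatrix.mulVec w = v) ↔ krylov A (1 : Matrix ι ι F) v = 0 := by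
  constructor
  · rintro ⟨w, rfl⟩
    exact krylov_one_charmatrix A w
  · intro h
    obtain ⟨w, hw⟩ := exists_charmatrix_add_const A v
    refine ⟨w, ?_⟩
    rw [hw, h]
    ext1 i
    simp

/-! ### Top parts -/

/-- `P` and `Q` factor `f (A) ^ (e - 1)` through the matrix `C`, compatibly with the action of `A`,
and `f ^ e` annihilates `A`. -/
structure IsTopFactorization (f : F[X]) (e : ℕ) (A : Matrix ι ι F) (C : Matrix κ κ F)
    (P : Matrix ι κ F) (Q : Matrix κ ι F) : Prop where
  left_inv : ∃ P' : Matrix κ ι F, P' * P = 1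
  right_inv : ∃ Q' : Matrix ι κ F, Q * Q' = 1
  mul_left : Q * A = C * Q
  mul_right : A * P = P * C
  aeval_eq : aeval A (f ^ (e - 1)) = P * Q
  aeval_zero : aeval A (f ^ e) = 0

namespace IsTopFactorization

variable {f : F[X]} {e : ℕ} {A : Matrix ι ι F} {C : Matrix κ κ F} {P : Matrix ι κ F}
  {Q : Matrix κ ι F}

theorem charmatrix_range (h : IsTopFactorization f e A C P Q) (v : ι → F[X]) :
    ∃ w, A.charmatrix.mulVec w = f ^ e • v := by
  rw [mem_range_charmatrix_iff, krylov_smul, h.aeval_zero, Matrix.zero_mulVec]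

/-- Modulo the column space of $xI-A$, multiplication by $f^{e-1}$ is $PQ$. As `P` is injective, the
module in question is the kernel of evaluation at `A` followed by the surjection `Q`. -/
theorem card_charmatrix (h : IsTopFactorization f e A C P Q) :
    Nat.card ((ι → F[X]) ⧸ colon A.charmatrix (f ^ (e - 1))) = Nat.card (κ → F) := by
  obtain ⟨P', hP⟩ := h.left_inv
  obtain ⟨Q', hQ⟩ := h.right_inv
  let φ : (ι → F[X]) →+ (κ → F) :=
    { toFun := fun v => Q.mulVec (krylov A 1 v)
      map_zero' := by rw [krylov_zero, Matrix.mulVec_zero]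
      map_add' := fun v w => by rw [krylov_add, Matrix.mulVec_add] }
  have hφ : Function.Surjective φ := fun y =>
    ⟨fun i => Polynomial.C (Q'.mulVec y i), by
      change Q.mulVec (krylov A 1 _) = y
      rw [krylov_one_const, Matrix.mulVec_mulVec, hQ, Matrix.one_mulVec]⟩
  have hker : (colon A.charmatrix (f ^ (e - 1))).toAddSubgroup = φ.ker := by
    ext v
    rw [Submodule.mem_toAddSubgroup, mem_colon, mem_range_charmatrix_iff, krylov_smul, h.aeval_eq,
      ← Matrix.mulVec_mulVec, AddMonoidHom.mem_ker]
    refine ⟨fun h0 => ?_, fun h0 => ?_⟩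
    · have := congrArg P'.mulVec h0
      rwa [Matrix.mulVec_mulVec, hP, Matrix.one_mulVec, Matrix.mulVec_zero] at this
    · exact (congrArg P.mulVec h0).trans (Matrix.mulVec_zero P)
  change (colon A.charmatrix (f ^ (e - 1))).toAddSubgroup.index = _
  rw [hker, AddSubgroup.index_ker, AddMonoidHom.range_eq_top.mpr hφ]
  exact Nat.card_congr AddSubgroup.topEquiv.toEquiv

theorem smul_mem_annihilator (h : IsTopFactorization f e A C P Q) (U V : Matrix ι β F)
    (v : β → F[X]) : f ^ e • v ∈ annihilator A U V := fun p => by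
  rw [krylov_smul, h.aeval_zero, Matrix.zero_mulVec, Matrix.mulVec_zero, Matrix.mulVec_zero]

/-- The reduction from `A` to `C`: $U^Tp(A)\,PQ\,y=(P^TU)^Tp(C)\,Qy$, and `Q` carries the evaluation
at `A` with `V` to the one at `C` with `Q * V`. -/
theorem smul_mem_annihilator_iff (h : IsTopFactorization f e A C P Q) (U V : Matrix ι β F)
    (v : β → F[X]) : f ^ (e - 1) • v ∈ annihilator A U V ↔
      v ∈ annihilator C (P.transpose * U) (Q * V) := by
  refine forall_congr' fun p => ?_
  rw [krylov_smul, h.aeval_eq, ← mulVec_krylov h.mul_left, Matrix.mulVec_mulVec _ (aeval A p),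
    ← Matrix.mul_assoc, ← mul_aeval_of_mul_eq h.mul_right.symm, Matrix.transpose_mul,
    Matrix.transpose_transpose, ← Matrix.mulVec_mulVec, ← Matrix.mulVec_mulVec,
    ← Matrix.mulVec_mulVec]

end IsTopFactorization

/-! ### Minimal generators -/

theorem exists_isMinimalGenerator {b : ℕ} {A : Matrix ι ι F} {U V : Matrix ι (Fin b) F} {c : F[X]}
    (hc : c ≠ 0) (hcA : ∀ v, c • v ∈ annihilator A U V) :
    ∃ G, IsMinimalGenerator G (projection A U V) := by
  obtain ⟨-, -, bN, -⟩ := exists_smith_basis_of_smul_mem (Pi.basisFun F[X] (Fin b)) _ hc hcA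
  let G : Matrix (Fin b) (Fin b) F[X] := Matrix.of fun i j => (bN j : Fin b → F[X]) i
  have hcol : G.col = (annihilator A U V).subtype ∘ bN := rfl
  have hli : LinearIndependent F[X] G.col := by
    rw [hcol]
    exact bN.linearIndependent.map' (annihilator A U V).subtype (Submodule.ker_subtype _)
  have hspan : Submodule.span F[X] (Set.range G.col) = annihilator A U V := by
    rw [hcol, Set.range_comp, Submodule.span_image, bN.span_eq, Submodule.map_top,
      Submodule.range_subtype]
  have hmem : ∀ v, v ∈ Submodule.span F[X] (Set.range G.col) ↔
      seqMulVec (projection A U V) v = 0 := fun v => by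
    rw [hspan, seqMulVec_projection_eq_zero_iff]
  refine ⟨G, ⟨fun hdet => ?_, ?_⟩, hli, hmem⟩
  · obtain ⟨v, hv, h0⟩ := Matrix.exists_mulVec_eq_zero_iff.mpr hdet
    refine hv (Matrix.mulVec_injective_iff.mpr hli ?_)
    rw [h0, Matrix.mulVec_zero]
  · ext1 k
    ext p j
    have := (hmem (G.col j)).mp (Submodule.subset_span ⟨j, rfl⟩)
    exact congrFun (congrFun this k) p

theorem IsMinimalGenerator.mem_range_iff {b : ℕ} {A : Matrix ι ι F} {U V : Matrix ι (Fin b) F}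
    {G : Matrix (Fin b) (Fin b) F[X]} (hG : IsMinimalGenerator G (projection A U V))
    (v : Fin b → F[X]) : (∃ w, G.mulVec w = v) ↔ v ∈ annihilator A U V := by
  rw [← seqMulVec_projection_eq_zero_iff, ← hG.2.2, ← Matrix.range_mulVecLin]
  rfl

/-- Faithfulness depends on `U` and `V` only through `P.transpose * U` and `Q * V`. -/
theorem IsTopFactorization.exists_faithful_iff {f : F[X]} (hf : f.Monic) (hirr : Irreducible f)
    {e : ℕ} (he : 0 < e) {A : Matrix ι ι F} {C : Matrix κ κ F} {P : Matrix ι κ F}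
    {Q : Matrix κ ι F} (h : IsTopFactorization f e A C P Q)
    (hfin : 1 < Nat.card (F[X] ⧸ Ideal.span {f})) {t : ℕ}
    (hκ : Nat.card (κ → F) = Nat.card (F[X] ⧸ Ideal.span {f}) ^ t) {r : ℕ} (hr : r ≤ t) {b : ℕ}
    (U V : Matrix ι (Fin b) F) :
    (∃ G, IsMinimalGenerator G (projection A U V) ∧ IsFaithful r G A) ↔
      Nat.card (F[X] ⧸ Ideal.span {f}) ^ r ≤
        Nat.card ((Fin b → F[X]) ⧸ annihilator C (P.transpose * U) (Q * V)) := by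
  -- Exactly here `r ≤ t` enters: it makes the target invariant factors all equal to $f^e$.
  have hA : ∀ s, HasInvariantFactors A.charmatrix s → ∀ i < r, s i = f ^ e := fun s hs => by
    rw [forall_lt_eq_pow_iff hf hirr he h.charmatrix_range hs hfin, h.card_charmatrix, hκ]
    exact Nat.pow_le_pow_right hfin.le hr
  have hG : ∀ G, IsMinimalGenerator G (projection A U V) →
      (∀ v, ∃ w, G.mulVec w = f ^ e • v) ∧
      colon G (f ^ (e - 1)) = annihilator C (P.transpose * U) (Q * V) := fun G hG => by
    refine ⟨fun v => (hG.mem_range_iff _).mpr (h.smul_mem_annihilator U V v), ?_⟩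
    ext v
    rw [mem_colon, hG.mem_range_iff, h.smul_mem_annihilator_iff]
  constructor
  · rintro ⟨G, hmin, s, s', hs, hs', hss⟩
    obtain ⟨h1, h2⟩ := hG G hmin
    rw [← h2, ← forall_lt_eq_pow_iff hf hirr he h1 hs hfin]
    exact fun i hi => (hss i hi).trans (hA s' hs' i hi)
  · intro hle
    obtain ⟨G, hmin⟩ := exists_isMinimalGenerator (pow_ne_zero e hirr.ne_zero)
      (h.smul_mem_annihilator U V)
    obtain ⟨h1, h2⟩ := hG G hmin
    obtain ⟨s, hs⟩ := exists_hasInvariantFactors hf hirr hmin.1.1 h1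
    obtain ⟨s', hs'⟩ := exists_hasInvariantFactors hf hirr
      (M := A.charmatrix) A.charpoly_monic.ne_zero h.charmatrix_range
    rw [← h2, ← forall_lt_eq_pow_iff hf hirr he h1 hs hfin] at hle
    exact ⟨G, hmin, s, s', hs, hs', fun i hi => (hle i hi).trans (hA s' hs' i hi).symm⟩

/-! ### Uniform fibres -/

/-- Every fibre of `φ` is a coset of its kernel. -/
theorem card_subtype_comp_of_surjective {G H : Type*} [AddGroup G] [AddGroup H] (φ : G →+ H)
    (hφ : Function.Surjective φ) (p : H → Prop) :
    Nat.card {g // p (φ g)} = Nat.card {h // p h} * Nat.card φ.ker := by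
  choose s hs using hφ
  rw [← Nat.card_prod]
  exact Nat.card_congr
    { toFun := fun g => (⟨φ g, g.2⟩, ⟨-s (φ g) + g, by simp [AddMonoidHom.mem_ker, hs]⟩)
      invFun := fun x => ⟨s x.1 + x.2, by
        rw [map_add, hs, AddMonoidHom.mem_ker.mp x.2.2, add_zero]
        exact x.1.2⟩
      left_inv := fun g => by ext; simp
      right_inv := fun x => by
        have h1 : φ (s x.1 + x.2) = x.1 := by
          rw [map_add, hs, AddMonoidHom.mem_ker.mp x.2.2, add_zero]
        ext
        · exact h1
        · simp [h1] }

theorem IsTopFactorization.prob_eq [Finite F] {f : F[X]} (hf : f.Monic) (hirr : Irreducible f)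
    {e : ℕ} (he : 0 < e) {A : Matrix ι ι F} {C : Matrix κ κ F} {P : Matrix ι κ F}
    {Q : Matrix κ ι F} (h : IsTopFactorization f e A C P Q)
    (hfin : 1 < Nat.card (F[X] ⧸ Ideal.span {f})) {t : ℕ}
    (hκ : Nat.card (κ → F) = Nat.card (F[X] ⧸ Ideal.span {f}) ^ t) {r : ℕ} (hr : r ≤ t) (b : ℕ) :
    prob b r A =
      (Nat.card {W : Matrix κ (Fin b) F × Matrix κ (Fin b) F //
        Nat.card (F[X] ⧸ Ideal.span {f}) ^ r ≤
          Nat.card ((Fin b → F[X]) ⧸ annihilator C W.1 W.2)} : ℚ) /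
        (Nat.card (Matrix κ (Fin b) F × Matrix κ (Fin b) F) : ℚ) := by
  obtain ⟨P', hP⟩ := h.left_inv
  obtain ⟨Q', hQ⟩ := h.right_inv
  let φ : Matrix ι (Fin b) F × Matrix ι (Fin b) F →+ Matrix κ (Fin b) F × Matrix κ (Fin b) F :=
    { toFun := fun W => (P.transpose * W.1, Q * W.2)
      map_zero' := by simp
      map_add' := fun V W => by simp [Matrix.mul_add] }
  have hφ : Function.Surjective φ := fun W =>
    ⟨(P'.transpose * W.1, Q' * W.2), by
      change (P.transpose * (P'.transpose * W.1), Q * (Q' * W.2)) = W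
      rw [← Matrix.mul_assoc, ← Matrix.mul_assoc, ← Matrix.transpose_mul, hP, hQ,
        Matrix.transpose_one, Matrix.one_mul, Matrix.one_mul]⟩
  let p : Matrix κ (Fin b) F × Matrix κ (Fin b) F → Prop := fun W =>
    Nat.card (F[X] ⧸ Ideal.span {f}) ^ r ≤ Nat.card ((Fin b → F[X]) ⧸ annihilator C W.1 W.2)
  have h1 := card_subtype_comp_of_surjective φ hφ p
  -- The trivial predicate counts all pairs, so the kernel size cancels in the quotient.
  have h2 := card_subtype_comp_of_surjective φ hφ fun _ => True
  rw [Nat.card_congr (Equiv.subtypeUnivEquiv fun _ => trivial),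
    Nat.card_congr (Equiv.subtypeUnivEquiv fun _ => trivial)] at h2
  have hk : (Nat.card φ.ker : ℚ) ≠ 0 := Nat.cast_ne_zero.mpr Nat.card_pos.ne'
  have h3 : Nat.card {W : Matrix ι (Fin b) F × Matrix ι (Fin b) F //
      ∃ G, IsMinimalGenerator G (projection A W.1 W.2) ∧ IsFaithful r G A} =
      Nat.card {W // p (φ W)} :=
    Nat.card_congr (Equiv.subtypeEquivRight fun W =>
      h.exists_faithful_iff hf hirr he hfin hκ hr W.1 W.2)
  rw [prob, h3, h1, h2, Nat.cast_mul, Nat.cast_mul, mul_div_mul_right _ _ hk]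

end Krylov

/-! ### Polynomials evaluated at a nilpotent perturbation of a root -/

section Perturbation

variable {F : Type*} [Field F]

/-- Taylor expansion gives $f(y+z)=(f'(y)+kz)z$. In the power $e-1$ the terms coming from $kz$ carry
a factor $z^e=0$. -/
theorem aeval_add_of_nilpotent {R : Type*} [CommRing R] [Algebra F R] (f : F[X]) {y z : R}
    (hy : aeval y f = 0) {e : ℕ} (he : 0 < e) (hz : z ^ e = 0) :
    aeval (y + z) (f ^ (e - 1)) = aeval y (derivative f) ^ (e - 1) * z ^ (e - 1) ∧
      aeval (y + z) (f ^ e) = 0 := by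
  obtain ⟨k, hk⟩ := (f.map (algebraMap F R)).binomExpansion y z
  simp only [derivative_map, eval_map_algebraMap, hy, zero_add] at hk
  have hfz : aeval (y + z) f = (aeval y (derivative f) + k * z) * z := by rw [hk]; ring
  obtain ⟨w, hw⟩ := sub_dvd_pow_sub_pow (aeval y (derivative f) + k * z) (aeval y (derivative f))
    (e - 1)
  have hz' : z * z ^ (e - 1) = 0 := by rw [← pow_succ', Nat.sub_add_cancel he, hz]
  rw [map_pow, map_pow, hfz, mul_pow, mul_pow, hz, mul_zero, sub_eq_iff_eq_add.mp hw]
  refine ⟨?_, rfl⟩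
  linear_combination (k * w) * hz'

theorem aeval_map_add_of_nilpotent {S R : Type*} [CommRing S] [Algebra F S] [Ring R] [Algebra F R]
    (φ : S →ₐ[F] R) (hφ : Function.Injective φ) (f : F[X]) {y z : S}
    (hy : aeval (φ y) f = 0) {e : ℕ} (he : 0 < e) (hz : φ z ^ e = 0) :
    aeval (φ y + φ z) (f ^ (e - 1)) = aeval (φ y) (derivative f) ^ (e - 1) * φ z ^ (e - 1) ∧
      aeval (φ y + φ z) (f ^ e) = 0 := by
  rw [Polynomial.aeval_algHom_apply, map_eq_zero_iff φ hφ] at hy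
  rw [← map_pow, map_eq_zero_iff φ hφ] at hz
  obtain ⟨h1, h2⟩ := aeval_add_of_nilpotent f hy he hz
  rw [← map_add, Polynomial.aeval_algHom_apply, Polynomial.aeval_algHom_apply,
    Polynomial.aeval_algHom_apply, h1, h2, map_mul, map_pow, map_pow, map_zero]
  exact ⟨rfl, rfl⟩

/-- Commuting `y` and `z` generate a commutative subalgebra, where the Taylor expansion is
available. -/
theorem aeval_add_of_commute_of_nilpotent {R : Type*} [Ring R] [Algebra F R] (f : F[X]) {y z : R}
    (hyz : Commute y z) (hy : aeval y f = 0) {e : ℕ} (he : 0 < e) (hz : z ^ e = 0) :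
    aeval (y + z) (f ^ (e - 1)) = aeval y (derivative f) ^ (e - 1) * z ^ (e - 1) ∧
      aeval (y + z) (f ^ e) = 0 := by
  have hcomm : ∀ a ∈ ({y, z} : Set R), ∀ b ∈ ({y, z} : Set R), a * b = b * a := by
    rintro a (rfl | rfl) b (rfl | rfl)
    exacts [rfl, hyz.eq, hyz.eq.symm, rfl]
  have hS := Algebra.isMulCommutative_adjoin F hcomm
  let : CommRing (Algebra.adjoin F ({y, z} : Set R)) :=
    { (inferInstance : Ring (Algebra.adjoin F ({y, z} : Set R))) with
      mul_comm := hS.is_comm.comm }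
  let y' : Algebra.adjoin F ({y, z} : Set R) := ⟨y, Algebra.subset_adjoin (Set.mem_insert _ _)⟩
  let z' : Algebra.adjoin F ({y, z} : Set R) :=
    ⟨z, Algebra.subset_adjoin (Set.mem_insert_of_mem _ rfl)⟩
  exact aeval_map_add_of_nilpotent (y := y') (z := z') (Algebra.adjoin F ({y, z} : Set R)).val
    Subtype.val_injective f hy he hz

end Perturbation

/-! ### Companion matrices and Jordan blocks -/

section Jordan

variable {F : Type*} [Field F]

/-- The companion matrix is multiplication by the root in the power basis of $\mathbb F[x]/(f)$. -/
theorem companion_eq_leftMulMatrix {f : F[X]} (hf : f.Monic) :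
    companion f = Algebra.leftMulMatrix (AdjoinRoot.powerBasis' hf).basis (AdjoinRoot.root f) := by
  have h := (AdjoinRoot.powerBasis' hf).leftMulMatrix
  rw [PowerBasis.minpolyGen_eq, AdjoinRoot.powerBasis'_gen, AdjoinRoot.minpoly_root hf.ne_zero,
    hf.leadingCoeff, inv_one, C_1, mul_one] at h
  exact h.symm

theorem aeval_companion {f : F[X]} (hf : f.Monic) : aeval (companion f) f = 0 := by
  have h := Polynomial.aeval_algHom_apply
    (Algebra.leftMulMatrix (AdjoinRoot.powerBasis' hf).basis) (AdjoinRoot.root f) f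
  rw [AdjoinRoot.aeval_eq, AdjoinRoot.mk_self, map_zero] at h
  rw [companion_eq_leftMulMatrix hf]
  exact h

theorem isUnit_aeval_companion_derivative {f : F[X]} (hf : f.Monic) (hsep : f.Separable) :
    IsUnit (aeval (companion f) (derivative f)) := by
  obtain ⟨a, b, hab⟩ := hsep
  have h := congrArg (aeval (companion f)) hab
  rw [map_add, map_mul, map_mul, aeval_companion hf, mul_zero, zero_add, map_one] at h
  exact IsUnit.of_mul_eq_one_right _ h

/-! ### Jordan blocks as Kronecker sums -/

open scoped Kronecker

/-- The nilpotent matrix with ones just below the diagonal. -/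
def shiftMatrix (F : Type*) [Field F] (e : ℕ) : Matrix (Fin e) (Fin e) F :=
  Matrix.of fun i j => if (i : ℕ) = j + 1 then 1 else 0

theorem shiftMatrix_pow_apply {e : ℕ} (k : ℕ) (i j : Fin e) :
    (shiftMatrix F e ^ k) i j = if (i : ℕ) = j + k then 1 else 0 := by
  induction k generalizing j with
  | zero => simp [Matrix.one_apply, Fin.ext_iff]
  | succ k ih =>
    rw [pow_succ, Matrix.mul_apply]
    simp only [ih, show ∀ l, shiftMatrix F e l j = if (l : ℕ) = j + 1 then 1 else 0 from
      fun _ => rfl, mul_ite, mul_one, mul_zero]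
    by_cases hj : (j : ℕ) + 1 < e
    · rw [Finset.sum_eq_single ⟨j + 1, hj⟩]
      · simp [add_assoc, add_comm 1 k]
      · intro l _ hl
        rw [if_neg fun h => hl (Fin.ext h)]
      · simp
    · rw [Finset.sum_eq_zero fun l _ => if_neg fun h => hj (by omega), if_neg (by omega)]

theorem shiftMatrix_pow_eq_zero {e k : ℕ} (h : e ≤ k) : shiftMatrix F e ^ k = 0 := by
  ext i j
  rw [shiftMatrix_pow_apply, if_neg (by omega)]
  rfl

theorem jordanBlock_eq (f : F[X]) (e : ℕ) :
    jordanBlock f e = (1 : Matrix (Fin e) (Fin e) F) ⊗ₖ companion f +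
      shiftMatrix F e ⊗ₖ (1 : Matrix (Fin f.natDegree) (Fin f.natDegree) F) := by
  ext ⟨i, x⟩ ⟨j, y⟩
  simp only [jordanBlock, Matrix.of_apply, Matrix.add_apply, Matrix.kronecker_apply, shiftMatrix]
  by_cases h : i = j
  · subst h
    simp
  · simp [h]

theorem kronecker_pow {m n : Type*} [Fintype m] [Fintype n] [DecidableEq m] [DecidableEq n]
    (A : Matrix m m F) (B : Matrix n n F) (k : ℕ) : (A ⊗ₖ B) ^ k = (A ^ k) ⊗ₖ (B ^ k) := by
  induction k with
  | zero => simp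
  | succ k ih => rw [pow_succ, ih, ← Matrix.mul_kronecker_mul, ← pow_succ, ← pow_succ]

theorem aeval_one_kronecker {m n : Type*} [Fintype m] [Fintype n] [DecidableEq m] [DecidableEq n]
    (B : Matrix n n F) (p : F[X]) :
    aeval ((1 : Matrix m m F) ⊗ₖ B) p = (1 : Matrix m m F) ⊗ₖ aeval B p := by
  induction p using Polynomial.induction_on' with
  | add p q hp hq => rw [map_add, map_add, hp, hq, Matrix.kronecker_add]
  | monomial k a =>
    rw [aeval_monomial, aeval_monomial, ← Algebra.smul_def, ← Algebra.smul_def, kronecker_pow,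
      one_pow, Matrix.kronecker_smul]

/-- The block size `e` may be smaller than `E`, as all blocks are raised to the exponent of the
largest. For `e < E` the shift power is zero, so shorter blocks contribute nothing. -/
theorem aeval_jordanBlock {f : F[X]} (hf : f.Monic) {e E : ℕ} (he : e ≤ E) (hE : 0 < E) :
    aeval (jordanBlock f e) (f ^ (E - 1)) =
        (shiftMatrix F e ^ (E - 1)) ⊗ₖ (aeval (companion f) (derivative f) ^ (E - 1)) ∧
      aeval (jordanBlock f e) (f ^ E) = 0 := by
  have hcomm : Commute ((1 : Matrix (Fin e) (Fin e) F) ⊗ₖ companion f)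
      (shiftMatrix F e ⊗ₖ (1 : Matrix (Fin f.natDegree) (Fin f.natDegree) F)) := by
    rw [Commute, SemiconjBy, ← Matrix.mul_kronecker_mul, ← Matrix.mul_kronecker_mul,
      Matrix.one_mul, Matrix.mul_one, Matrix.one_mul, Matrix.mul_one]
  have h := aeval_add_of_commute_of_nilpotent f hcomm
    (by rw [aeval_one_kronecker, aeval_companion hf, Matrix.kronecker_zero]) hE
    (by rw [kronecker_pow, shiftMatrix_pow_eq_zero he, Matrix.zero_kronecker])
  rw [← jordanBlock_eq, aeval_one_kronecker, kronecker_pow, kronecker_pow,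
    ← Matrix.mul_kronecker_mul, one_pow, one_pow, Matrix.one_mul, Matrix.mul_one] at h
  exact h

theorem aeval_blockDiagonal' {o : Type*} [Fintype o] [DecidableEq o] {n : o → Type*}
    [∀ i, Fintype (n i)] [∀ i, DecidableEq (n i)] (M : ∀ i, Matrix (n i) (n i) F) (p : F[X]) :
    aeval (Matrix.blockDiagonal' M) p = Matrix.blockDiagonal' fun i => aeval (M i) p := by
  induction p using Polynomial.induction_on' with
  | add p q hp hq =>
    rw [map_add, hp, hq, ← Matrix.blockDiagonal'_add]
    congr 1
    ext1 i
    simp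
  | monomial k a =>
    simp only [aeval_monomial, ← Algebra.smul_def]
    rw [← Matrix.blockDiagonal'_pow, ← Matrix.blockDiagonal'_smul]
    rfl

/-- The matrix of the coordinate inclusion along `g`. -/
def inclusionMatrix (F : Type*) [Field F] {ι κ : Type*} [DecidableEq ι] (g : κ → ι) :
    Matrix ι κ F :=
  Matrix.of fun i k => if i = g k then 1 else 0

/-! ### Coordinate inclusions and the factorization they give -/

section Inclusion

variable {ι κ : Type*} [DecidableEq ι] {g : κ → ι}

theorem mul_inclusionMatrix [Fintype ι] {μ : Type*} (M : Matrix μ ι F) :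
    M * inclusionMatrix F g = M.submatrix id g := by
  ext i j
  simp [inclusionMatrix, Matrix.mul_apply]

theorem inclusionMatrix_transpose_mul [Fintype ι] {μ : Type*} (M : Matrix ι μ F) :
    (inclusionMatrix F g).transpose * M = M.submatrix g id := by
  ext i j
  simp [inclusionMatrix, Matrix.mul_apply]

theorem inclusionMatrix_transpose_mul_self [Fintype ι] [DecidableEq κ] (hg : Function.Injective g) :
    (inclusionMatrix F g).transpose * inclusionMatrix F g = 1 := by
  rw [inclusionMatrix_transpose_mul]
  ext i j
  simp [Matrix.one_apply, inclusionMatrix, hg.eq_iff]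

variable [Fintype κ]

theorem inclusionMatrix_mul_apply {μ : Type*} (hg : Function.Injective g) (M : Matrix κ μ F)
    (k : κ) (l : μ) : (inclusionMatrix F g * M) (g k) l = M k l := by
  rw [Matrix.mul_apply, Finset.sum_eq_single k]
  · simp [inclusionMatrix]
  · intro k' _ hk'
    simp [inclusionMatrix, hg.ne hk'.symm]
  · simp

theorem inclusionMatrix_mul_apply_of_notMem {μ : Type*} (M : Matrix κ μ F) {i : ι}
    (hi : i ∉ Set.range g) (l : μ) : (inclusionMatrix F g * M) i l = 0 := by
  rw [Matrix.mul_apply]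
  refine Finset.sum_eq_zero fun k _ => ?_
  simp [inclusionMatrix, show i ≠ g k from fun h => hi ⟨k, h.symm⟩]

theorem mul_inclusionMatrix_transpose_apply {μ : Type*} (hg : Function.Injective g)
    (M : Matrix μ κ F) (k : κ) (l : μ) :
    (M * (inclusionMatrix F g).transpose) l (g k) = M l k := by
  rw [← Matrix.transpose_apply (M * _), Matrix.transpose_mul, Matrix.transpose_transpose,
    inclusionMatrix_mul_apply hg, Matrix.transpose_apply]

theorem mul_inclusionMatrix_transpose_apply_of_notMem {μ : Type*} (M : Matrix μ κ F) {i : ι}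
    (hi : i ∉ Set.range g) (l : μ) : (M * (inclusionMatrix F g).transpose) l i = 0 := by
  rw [← Matrix.transpose_apply (M * _), Matrix.transpose_mul, Matrix.transpose_transpose,
    inclusionMatrix_mul_apply_of_notMem _ hi]

variable [Fintype ι] [DecidableEq κ]

/-- Here $f(A)^{e-1}$ is a single invertible array `D` with rows `bot` and columns `top`. The zero
conditions say that the `top` rows and the `bot` columns of `A` involve only `C`; commutation of `C`
with `D` lets `D` be absorbed into `P`. -/
theorem isTopFactorization_of_injective {f : F[X]} {e : ℕ} {A : Matrix ι ι F} {C D : Matrix κ κ F}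
    {top bot : κ → ι} (htop : Function.Injective top) (hbot : Function.Injective bot)
    (htt : ∀ k l, A (top k) (top l) = C k l) (htn : ∀ k, ∀ i ∉ Set.range top, A (top k) i = 0)
    (hbb : ∀ k l, A (bot k) (bot l) = C k l) (hbn : ∀ k, ∀ i ∉ Set.range bot, A i (bot k) = 0)
    (hD : IsUnit D) (hDC : Commute C D)
    (hbt : ∀ k l, aeval A (f ^ (e - 1)) (bot k) (top l) = D k l)
    (h0 : ∀ i j, aeval A (f ^ (e - 1)) i j ≠ 0 → i ∈ Set.range bot ∧ j ∈ Set.range top)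
    (hzero : aeval A (f ^ e) = 0) :
    IsTopFactorization f e A C (inclusionMatrix F bot * D) (inclusionMatrix F top).transpose where
  left_inv := by
    obtain ⟨u, rfl⟩ := hD
    refine ⟨(u⁻¹ : (Matrix κ κ F)ˣ).val * (inclusionMatrix F bot).transpose, ?_⟩
    rw [Matrix.mul_assoc, ← Matrix.mul_assoc _ _ (u : Matrix κ κ F),
      inclusionMatrix_transpose_mul_self hbot, Matrix.one_mul, Units.inv_mul]
  right_inv := ⟨_, inclusionMatrix_transpose_mul_self htop⟩
  mul_left := by
    ext k i
    rw [inclusionMatrix_transpose_mul]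
    by_cases hi : i ∈ Set.range top
    · obtain ⟨l, rfl⟩ := hi
      rw [mul_inclusionMatrix_transpose_apply htop]
      exact htt k l
    · rw [mul_inclusionMatrix_transpose_apply_of_notMem _ hi]
      exact htn k i hi
  mul_right := by
    rw [Matrix.mul_assoc, ← hDC.eq, ← Matrix.mul_assoc, ← Matrix.mul_assoc]
    congr 1
    ext i k
    rw [mul_inclusionMatrix]
    by_cases hi : i ∈ Set.range bot
    · obtain ⟨l, rfl⟩ := hi
      rw [inclusionMatrix_mul_apply hbot]
      exact hbb l k
    · rw [inclusionMatrix_mul_apply_of_notMem _ hi]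
      exact hbn k i hi
  aeval_eq := by
    ext i j
    by_cases hj : j ∈ Set.range top
    · by_cases hi : i ∈ Set.range bot
      · obtain ⟨l, rfl⟩ := hj
        obtain ⟨k, rfl⟩ := hi
        rw [mul_inclusionMatrix_transpose_apply htop, inclusionMatrix_mul_apply hbot, hbt]
      · rw [Matrix.mul_assoc, inclusionMatrix_mul_apply_of_notMem _ hi]
        exact not_not.mp fun h => hi (h0 i j h).1
    · rw [mul_inclusionMatrix_transpose_apply_of_notMem _ hj]
      exact not_not.mp fun h => hj (h0 i j h).2
  aeval_zero := hzero

end Inclusion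

theorem blockDiagonal'_const_apply {t : ℕ} {n : Type*} (M : Matrix n n F) (j j' : Fin t)
    (x x' : n) : Matrix.blockDiagonal' (fun _ : Fin t => M) ⟨j, x⟩ ⟨j', x'⟩ =
      if j = j' then M x x' else 0 := by
  by_cases h : j = j'
  · subst h
    rw [Matrix.blockDiagonal'_apply_eq, if_pos rfl]
  · rw [Matrix.blockDiagonal'_apply_ne _ _ _ h, if_neg h]

/-- The $(E-1)$-st power of the shift has a single one, in its bottom-left corner, for blocks of
size `E`. Hence `top` and `bot` pick the first and last sub-block of each largest Jordan block, with
corner $f'(C_f)^{E-1}$, invertible because `f` is separable. -/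
theorem exists_isTopFactorization_jordan {f : F[X]} (hf : f.Monic) (hsep : f.Separable)
    {m t : ℕ} (e : Fin m → ℕ) {E : ℕ} (hE : 0 < E) (hle : ∀ i, e i ≤ E) (htm : t ≤ m)
    (ht : ∀ i : Fin m, e i = E ↔ (i : ℕ) < t) :
    ∃ P Q, IsTopFactorization f E (Matrix.blockDiagonal' fun i => jordanBlock f (e i))
      (Matrix.blockDiagonal' fun _ : Fin t => companion f) P Q := by
  have heE : ∀ j : Fin t, e (j.castLE htm) = E := fun j => (ht _).mpr j.2
  let top : (Σ _ : Fin t, Fin f.natDegree) → Σ i, Fin (e i) × Fin f.natDegree := fun k =>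
    ⟨k.1.castLE htm, ⟨0, by rw [heE]; exact hE⟩, k.2⟩
  let bot : (Σ _ : Fin t, Fin f.natDegree) → Σ i, Fin (e i) × Fin f.natDegree := fun k =>
    ⟨k.1.castLE htm, ⟨E - 1, by rw [heE]; omega⟩, k.2⟩
  have htop : Function.Injective top := by
    rintro ⟨j, x⟩ ⟨j', x'⟩ h
    obtain rfl : j = j' := Fin.castLE_injective htm (congrArg Sigma.fst h)
    simpa [top] using h
  have hbot : Function.Injective bot := by
    rintro ⟨j, x⟩ ⟨j', x'⟩ h
    obtain rfl : j = j' := Fin.castLE_injective htm (congrArg Sigma.fst h)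
    simpa [bot] using h
  have hdiag : ∀ g : (Σ _ : Fin t, Fin f.natDegree) → Σ i, Fin (e i) × Fin f.natDegree,
      (∃ a : ∀ j : Fin t, Fin (e (j.castLE htm)), ∀ k, g k = ⟨k.1.castLE htm, a k.1, k.2⟩) →
      ∀ k l, Matrix.blockDiagonal' (fun i => jordanBlock f (e i)) (g k) (g l) =
        Matrix.blockDiagonal' (fun _ : Fin t => companion f) k l := by
    rintro g ⟨a, ha⟩ ⟨j, x⟩ ⟨j', x'⟩
    rw [ha, ha, blockDiagonal'_const_apply]
    split_ifs with h
    · subst h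
      rw [Matrix.blockDiagonal'_apply_eq]
      simp [jordanBlock]
    · exact Matrix.blockDiagonal'_apply_ne _ _ _ fun h' => h (Fin.castLE_injective htm h')
  have hB : aeval (Matrix.blockDiagonal' fun i => jordanBlock f (e i)) (f ^ (E - 1)) =
      Matrix.blockDiagonal' fun i => (shiftMatrix F (e i) ^ (E - 1)) ⊗ₖ
        (aeval (companion f) (derivative f) ^ (E - 1)) := by
    rw [aeval_blockDiagonal']
    congr 1
    ext1 i
    exact (aeval_jordanBlock hf (hle i) hE).1
  refine ⟨_, _, isTopFactorization_of_injective
    (D := Matrix.blockDiagonal' fun _ : Fin t => aeval (companion f) (derivative f) ^ (E - 1))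
    htop hbot (hdiag top ⟨fun j => ⟨0, by rw [heE]; exact hE⟩, fun _ => rfl⟩) ?_
    (hdiag bot ⟨fun j => ⟨E - 1, by rw [heE]; omega⟩, fun _ => rfl⟩) ?_ ?_ ?_ ?_ ?_ ?_⟩
  · rintro ⟨j, x⟩ ⟨i, a, y⟩ hn
    by_cases hi : j.castLE htm = i
    · subst hi
      rw [Matrix.blockDiagonal'_apply_eq]
      have ha : (a : ℕ) ≠ 0 := fun h => hn ⟨⟨j, y⟩, by
        have : a = ⟨0, by rw [heE]; exact hE⟩ := Fin.ext h
        rw [this]⟩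
      simp [jordanBlock, Fin.ext_iff, ha.symm]
    · exact Matrix.blockDiagonal'_apply_ne _ _ _ hi
  · rintro ⟨j, x⟩ ⟨i, a, y⟩ hn
    by_cases hi : i = j.castLE htm
    · subst hi
      rw [Matrix.blockDiagonal'_apply_eq]
      have ha : (a : ℕ) ≠ E - 1 := fun h => hn ⟨⟨j, y⟩, by
        have : a = ⟨E - 1, by rw [heE]; omega⟩ := Fin.ext h
        rw [this]⟩
      -- The last block column has no identity block below its diagonal block.
      have ha' : (a : ℕ) ≠ E - 1 + 1 := by
        have := a.2
        have := heE j
        omega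
      simp [jordanBlock, Fin.ext_iff, ha, ha']
    · exact Matrix.blockDiagonal'_apply_ne _ _ _ hi
  · obtain ⟨u, hu⟩ := (isUnit_aeval_companion_derivative hf hsep).pow (E - 1)
    rw [← hu]
    refine isUnit_iff_exists.mpr ⟨Matrix.blockDiagonal' fun _ => (u⁻¹ : (Matrix _ _ F)ˣ).val, ?_, ?_⟩
    · rw [← Matrix.blockDiagonal'_mul]
      simp only [Units.mul_inv]
      exact Matrix.blockDiagonal'_one
    · rw [← Matrix.blockDiagonal'_mul]
      simp only [Units.inv_mul]
      exact Matrix.blockDiagonal'_one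
  · have : Commute (companion f) (aeval (companion f) (derivative f) ^ (E - 1)) := by
      rw [← map_pow]
      nth_rewrite 1 [← aeval_X (R := F) (companion f)]
      exact (Commute.all _ _).map (aeval (companion f))
    rw [Commute, SemiconjBy, ← Matrix.blockDiagonal'_mul, ← Matrix.blockDiagonal'_mul]
    simp only [this.eq]
  · rintro ⟨j, x⟩ ⟨j', x'⟩
    rw [hB, blockDiagonal'_const_apply]
    split_ifs with h
    · subst h
      rw [Matrix.blockDiagonal'_apply_eq, Matrix.kronecker_apply, shiftMatrix_pow_apply]
      simp
    · exact Matrix.blockDiagonal'_apply_ne _ _ _ fun h' => h (Fin.castLE_injective htm h')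
  · rintro ⟨i, a, x⟩ ⟨i', a', x'⟩ h
    rw [hB] at h
    by_cases hi : i = i'
    · subst hi
      rw [Matrix.blockDiagonal'_apply_eq, Matrix.kronecker_apply, shiftMatrix_pow_apply] at h
      have haa : (a : ℕ) = a' + (E - 1) := by
        by_contra hne
        exact h (by rw [if_neg hne, zero_mul])
      have h1 := a.2
      have h2 := hle i
      obtain ⟨j, rfl⟩ : ∃ j : Fin t, i = j.castLE htm := ⟨⟨i, (ht i).mp (by omega)⟩, rfl⟩
      have ha : a = ⟨E - 1, by omega⟩ := Fin.ext (by dsimp only; omega)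
      have ha' : a' = ⟨0, by omega⟩ := Fin.ext (by dsimp only; omega)
      exact ⟨⟨⟨j, x⟩, by rw [ha]⟩, ⟨⟨j, x'⟩, by rw [ha']⟩⟩
    · exact absurd (Matrix.blockDiagonal'_apply_ne _ _ _ hi) h
  · rw [aeval_blockDiagonal', ← Matrix.blockDiagonal'_zero]
    congr 1
    ext1 i
    exact (aeval_jordanBlock hf (hle i) hE).2

theorem isTopFactorization_companion {f : F[X]} (hf : f.Monic) (t : ℕ) :
    IsTopFactorization f 1 (Matrix.blockDiagonal' fun _ : Fin t => companion f)
      (Matrix.blockDiagonal' fun _ : Fin t => companion f) 1 1 where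
  left_inv := ⟨1, Matrix.one_mul 1⟩
  right_inv := ⟨1, Matrix.one_mul 1⟩
  mul_left := by rw [Matrix.one_mul, Matrix.mul_one]
  mul_right := by rw [Matrix.one_mul, Matrix.mul_one]
  aeval_eq := by simp
  aeval_zero := by
    rw [pow_one, aeval_blockDiagonal', ← Matrix.blockDiagonal'_zero]
    simp only [aeval_companion hf]
    rfl

/-! ### Cardinalities of the residue field and of the reduced space -/

theorem card_quotient_span {f : F[X]} (hf : f.Monic) :
    Nat.card (F[X] ⧸ Ideal.span {f}) = Nat.card (Fin f.natDegree → F) :=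
  Nat.card_congr (AdjoinRoot.powerBasis' hf).basis.equivFun.toEquiv

theorem one_lt_card_quotient_span [Finite F] {f : F[X]} (hf : f.Monic) (hirr : Irreducible f) :
    1 < Nat.card (F[X] ⧸ Ideal.span {f}) := by
  rw [card_quotient_span hf]
  have : Nonempty (Fin f.natDegree) := ⟨⟨0, hirr.natDegree_pos⟩⟩
  exact Finite.one_lt_card

theorem card_sigma_fun {f : F[X]} (hf : f.Monic) (t : ℕ) :
    Nat.card ((Σ _ : Fin t, Fin f.natDegree) → F) = Nat.card (F[X] ⧸ Ideal.span {f}) ^ t := by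
  rw [card_quotient_span hf, Nat.card_congr (Equiv.piCurry fun _ _ => F), Nat.card_pi]
  simp

end Jordan

end BlockWiedemann

theorem mainTheorem7 {F : Type*} [Field F] [Finite F] (f : Polynomial F)
    (hmonic : f.Monic) (hirr : Irreducible f)
    (m : ℕ) (hm : 0 < m) (e : Fin m → ℕ) (hpos : ∀ i, 0 < e i) (hanti : Antitone e)
    (t : ℕ) (ht : IsGreatest {k : ℕ | ∃ i : Fin m, k = (i : ℕ) + 1 ∧ e i = e ⟨0, hm⟩} t)
    (b r : ℕ) (hr : r ≤ t) :
    BlockWiedemann.prob b r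
        (Matrix.blockDiagonal' fun i : Fin m => BlockWiedemann.jordanBlock f (e i)) =
      BlockWiedemann.prob b r
        (Matrix.blockDiagonal' fun _ : Fin t => BlockWiedemann.jordanBlock f (e ⟨0, hm⟩)) ∧
    BlockWiedemann.prob b r
        (Matrix.blockDiagonal' fun _ : Fin t => BlockWiedemann.jordanBlock f (e ⟨0, hm⟩)) =
      BlockWiedemann.prob b r
        (Matrix.blockDiagonal' fun _ : Fin t => BlockWiedemann.companion f) := by
  have hsep : f.Separable := PerfectField.separable_of_irreducible hirr
  have hle : ∀ i, e i ≤ e ⟨0, hm⟩ := fun i => hanti (Fin.mk_le_mk.mpr (Nat.zero_le i))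
  obtain ⟨⟨i₀, hi₀, hei₀⟩, hmax⟩ := ht
  have htm : t ≤ m := by omega
  -- `t` counts from one, so by monotonicity the largest blocks are those with zero-based index
  -- below `t`.
  have hlt : ∀ i : Fin m, e i = e ⟨0, hm⟩ ↔ (i : ℕ) < t := fun i =>
    ⟨fun h => hmax ⟨i, rfl, h⟩, fun h => le_antisymm (hle i)
      (hei₀ ▸ hanti (Fin.le_def.mpr (by omega)))⟩
  have hfin := BlockWiedemann.one_lt_card_quotient_span hmonic hirr
  have hcard := BlockWiedemann.card_sigma_fun hmonic t
  obtain ⟨P, Q, h1⟩ := BlockWiedemann.exists_isTopFactorization_jordan hmonic hsep e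
    (hpos ⟨0, hm⟩) hle htm hlt
  obtain ⟨P', Q', h2⟩ := BlockWiedemann.exists_isTopFactorization_jordan hmonic hsep
    (fun _ : Fin t => e ⟨0, hm⟩) (hpos ⟨0, hm⟩) (fun _ => le_rfl) le_rfl
    (fun i => iff_of_true rfl i.2)
  have h3 := BlockWiedemann.isTopFactorization_companion hmonic t
  -- All three matrices share the same `C`, so the three probabilities become one expression, free
  -- of the exponents.
  rw [h1.prob_eq hmonic hirr (hpos _) hfin hcard hr, h2.prob_eq hmonic hirr (hpos _) hfin hcard hr,
    h3.prob_eq hmonic hirr one_pos hfin hcard hr]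
  exact ⟨rfl, rfl⟩
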